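/- Consider the system $x_{k+1}=Ax_k+Bu_k+w_k$ with $x_k\in\mathbb{R}^n$, $u_k\in\mathbb{R}^m$, where $w_k\sim\mathcal{N}(0,\sigma_w^2)$ with a covariance matrix $\sigma_w^2\succeq 0$, the initial state $x_0$ and the inputs $u_k$ of the behavior policy have finite second moments, and each $w_k$ is independent of $(x_0,w_0,\dots,w_{k-1},u_0,\dots,u_k)$. Let $\gamma\in(0,1)$, $Q\succeq 0$, $R\succ 0$, $Q=CC'$, and let $(A,C)$ be detectable, i.e. $\rho(A+LC')<1$ for some matrix $L$. Let $F^0\in\mathbb{R}^{m\times n}$ be a stabilizing gain, $\rho(A+BF^0)\le 1$. Let $T\subseteq\mathbb{N}$ be the set of times at which data are collected. For a gain $F$, policy evaluation means solving the off-policy Bellman equations $$\mathbb{E}[x_k'Xx_k]-\gamma\,\mathbb{E}[x_{k+1}'Xx_{k+1}]=\mathbb{E}[x_k'(Q+F'RF)x_k]-2\gamma\,\mathbb{E}[(u_k-Fx_k)'X_1x_k]-\gamma\,\mathbb{E}[(u_k-Fx_k)'X_2(Fx_k+u_k)]-\gamma\operatorname{tr}(X\sigma_w^2),\qquad k\in T,$$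 for symmetric $X\in\mathbb{R}^{n\times n}$, arbitrary $X_1\in\mathbb{R}^{m\times n}$ and symmetric $X_2\in\mathbb{R}^{m\times m}$. Assume that the data are exciting in the sense that for $F=F^0$ this linear system has at most one solution (its coefficient matrix has full column rank). The model-free off-policy policy iteration computes, for $s=0,1,2,\dots$ (without stopping), a solution $(X^s,X_1^s,X_2^s)$ of the policy evaluation equations for $F=F^s$ and then $F^{s+1}=-\gamma(R+\gamma X_2^s)^{-1}X_1^s$. Then the iteration can be carried out, and for every $s$ the policy evaluation equations for $F^s$ have exactly one solution; it satisfies $$X^s=\gamma(A+BF^s)'X^s(A+BF^s)+(F^s)'RF^s+Q,\qquad X_1^s=B'X^sA,\qquad X_2^s=B'X^sB,$$ so that $F^{s+1}=-\gamma(R+\gamma B'X^sB)^{-1}B'X^sA$ as in classical policy iteration. Moreover, the discounted algebraic Riccati equation $$X=Q+\gamma A'XA-\gamma^2A'XB(R+\gamma B'XB)^{-1}B'XA$$ has a unique positive semidefinite solution $X^*$, and $$\lim_{s\to\infty}X^s=X^*,\qquad \lim_{s\to\infty}F^s=F^*:=-\gamma(R+\gamma B'X^*B)^{-1}B'X^*A.$$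 -/

import Mathlib

open Matrix Filter Topology MeasureTheory ProbabilityTheory

noncomputable section

/-- The spectral radius of a real square matrix: the largest modulus of its complex eigenvalues. -/
def matrixSpectralRadius {n : ℕ} (M : Matrix (Fin n) (Fin n) ℝ) : ENNReal :=
  spectralRadius ℂ (M.map (algebraMap ℝ ℂ))

/-- The set of stabilizing state-feedback gains, `{F | ρ(A + B F) ≤ 1}`. -/
def stabilizingGains {n m : ℕ} (A : Matrix (Fin n) (Fin n) ℝ) (B : Matrix (Fin n) (Fin m) ℝ) :
    Set (Matrix (Fin m) (Fin n) ℝ) :=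
  {F | matrixSpectralRadius (A + B * F) ≤ 1}

/-- Detectability of the system `x⁺ = A x` with output `y = H x`: some output injection `L` makes
`A + L H` Schur stable. -/
def IsDetectable {n p : ℕ} (A : Matrix (Fin n) (Fin n) ℝ) (H : Matrix (Fin p) (Fin n) ℝ) : Prop :=
  ∃ L : Matrix (Fin n) (Fin p) ℝ, matrixSpectralRadius (A + L * H) < 1

/-- The discounted algebraic Riccati equation
`X = Q + γ A'XA - γ² A'XB (R + γ B'XB)⁻¹ B'XA`. -/
def SolvesARE {n m : ℕ} (A : Matrix (Fin n) (Fin n) ℝ) (B : Matrix (Fin n) (Fin m) ℝ)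
    (Q : Matrix (Fin n) (Fin n) ℝ) (R : Matrix (Fin m) (Fin m) ℝ) (γ : ℝ)
    (X : Matrix (Fin n) (Fin n) ℝ) : Prop :=
  X = Q + γ • (Aᵀ * X * A)
    - γ ^ 2 • (Aᵀ * X * B * (R + γ • (Bᵀ * X * B))⁻¹ * (Bᵀ * X * A))

/-- The policy-improvement formula `-γ (R + γ X₂)⁻¹ X₁`. -/
def improvedGain {n m : ℕ} (R : Matrix (Fin m) (Fin m) ℝ) (γ : ℝ)
    (X₁ : Matrix (Fin m) (Fin n) ℝ) (X₂ : Matrix (Fin m) (Fin m) ℝ) : Matrix (Fin m) (Fin n) ℝ :=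
  -(γ • ((R + γ • X₂)⁻¹ * X₁))

/-- The gain `-γ (R + γ B'XB)⁻¹ B'XA`; at the solution of the Riccati equation this is the
optimal gain. -/
def gainOf {n m : ℕ} (A : Matrix (Fin n) (Fin n) ℝ) (B : Matrix (Fin n) (Fin m) ℝ)
    (R : Matrix (Fin m) (Fin m) ℝ) (γ : ℝ) (X : Matrix (Fin n) (Fin n) ℝ) :
    Matrix (Fin m) (Fin n) ℝ :=
  improvedGain R γ (Bᵀ * X * A) (Bᵀ * X * B)

/-- `x`, `u`, `w` are the state, input and noise processes of the system
`x (k+1) = A x k + B u k + w k` driven by a behavior policy `u`. The noise is Gaussian with mean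
zero and covariance `W`. The noise `w k` is independent of the initial state, of the earlier noise
and of the inputs applied up to time `k` (which may contain probing noise); in particular the
noises are mutually independent. The initial state and the inputs have finite second moments. -/
structure IsBehaviorTrajectory {n m : ℕ} {Ω : Type*} [MeasurableSpace Ω] (P : Measure Ω)
    (A : Matrix (Fin n) (Fin n) ℝ) (B : Matrix (Fin n) (Fin m) ℝ)
    (W : Matrix (Fin n) (Fin n) ℝ)
    (x : ℕ → Ω → (Fin n → ℝ)) (u : ℕ → Ω → (Fin m → ℝ)) (w : ℕ → Ω → (Fin n → ℝ)) : Prop where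
  dynamics : ∀ k ω, x (k + 1) ω = A *ᵥ x k ω + B *ᵥ u k ω + w k ω
  measurable_init : Measurable (x 0)
  measurable_input : ∀ k, Measurable (u k)
  measurable_noise : ∀ k, Measurable (w k)
  memLp_init : MemLp (x 0) 2 P
  memLp_input : ∀ k, MemLp (u k) 2 P
  law_noise : ∀ k, HasLaw (fun ω => WithLp.toLp 2 (w k ω)) (multivariateGaussian 0 W) P
  indep_noise : ∀ k, IndepFun (w k)
    (fun ω => (x 0 ω, (fun j : Fin k => w j ω), (fun j : Fin (k + 1) => u j ω))) P

/-- Policy evaluation for the target gain `F`: the symmetric matrix `X`, the matrix `X₁` and the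
symmetric matrix `X₂` satisfy the off-policy Bellman equation at every sampling time `k ∈ T`. -/
structure IsOffPolicyEvaluation {n m : ℕ} {Ω : Type*} [MeasurableSpace Ω] (P : Measure Ω)
    (Q : Matrix (Fin n) (Fin n) ℝ) (R : Matrix (Fin m) (Fin m) ℝ) (W : Matrix (Fin n) (Fin n) ℝ)
    (γ : ℝ) (x : ℕ → Ω → (Fin n → ℝ)) (u : ℕ → Ω → (Fin m → ℝ)) (T : Set ℕ)
    (F : Matrix (Fin m) (Fin n) ℝ)
    (X : Matrix (Fin n) (Fin n) ℝ) (X₁ : Matrix (Fin m) (Fin n) ℝ)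
    (X₂ : Matrix (Fin m) (Fin m) ℝ) : Prop where
  symm : X.IsSymm
  symm₂ : X₂.IsSymm
  bellman : ∀ k ∈ T,
    (∫ ω, x k ω ⬝ᵥ X *ᵥ x k ω ∂P) - γ * (∫ ω, x (k + 1) ω ⬝ᵥ X *ᵥ x (k + 1) ω ∂P)
      = (∫ ω, x k ω ⬝ᵥ (Q + Fᵀ * R * F) *ᵥ x k ω ∂P)
        - 2 * γ * (∫ ω, (u k ω - F *ᵥ x k ω) ⬝ᵥ X₁ *ᵥ x k ω ∂P)
        - γ * (∫ ω, (u k ω - F *ᵥ x k ω) ⬝ᵥ X₂ *ᵥ (F *ᵥ x k ω + u k ω) ∂P)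
        - γ * (X * W).trace

/-- The infinite sequences produced by off-policy policy iteration started at the gain `F₀`,
run without a stopping test. -/
structure IsOffPolicyIteration {n m : ℕ} {Ω : Type*} [MeasurableSpace Ω] (P : Measure Ω)
    (Q : Matrix (Fin n) (Fin n) ℝ) (R : Matrix (Fin m) (Fin m) ℝ) (W : Matrix (Fin n) (Fin n) ℝ)
    (γ : ℝ) (x : ℕ → Ω → (Fin n → ℝ)) (u : ℕ → Ω → (Fin m → ℝ)) (T : Set ℕ)
    (F₀ : Matrix (Fin m) (Fin n) ℝ)
    (F : ℕ → Matrix (Fin m) (Fin n) ℝ) (X : ℕ → Matrix (Fin n) (Fin n) ℝ)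
    (X₁ : ℕ → Matrix (Fin m) (Fin n) ℝ) (X₂ : ℕ → Matrix (Fin m) (Fin m) ℝ) : Prop where
  init : F 0 = F₀
  evaluation : ∀ s, IsOffPolicyEvaluation P Q R W γ x u T (F s) (X s) (X₁ s) (X₂ s)
  improvement : ∀ s, F (s + 1) = improvedGain R γ (X₁ s) (X₂ s)

/-- The data collected at the times in `T` determine the policy evaluation for the gain `F`: its
linear equations have at most one solution, that is, their coefficient matrix has full column
rank. -/
def DataDetermineEvaluation {n m : ℕ} {Ω : Type*} [MeasurableSpace Ω] (P : Measure Ω)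
    (Q : Matrix (Fin n) (Fin n) ℝ) (R : Matrix (Fin m) (Fin m) ℝ) (W : Matrix (Fin n) (Fin n) ℝ)
    (γ : ℝ) (x : ℕ → Ω → (Fin n → ℝ)) (u : ℕ → Ω → (Fin m → ℝ)) (T : Set ℕ)
    (F : Matrix (Fin m) (Fin n) ℝ) : Prop :=
  ∀ X X₁ X₂ Y Y₁ Y₂, IsOffPolicyEvaluation P Q R W γ x u T F X X₁ X₂ →
    IsOffPolicyEvaluation P Q R W γ x u T F Y Y₁ Y₂ → X = Y ∧ X₁ = Y₁ ∧ X₂ = Y₂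

end

/-! Put `D = X - (γ(A+BF)'X(A+BF) + F'RF + Q)`, `E₁ = X₁ - B'XA`, `E₂ = X₂ - B'XB`. Since the noise
is centered and independent of `(x_k, u_k)`, the off-policy equation at time `k` says that the
expectation of a quadratic form in `(x_k, u_k)`, linear in `(D, E₁, E₂)`, vanishes
(`IsBehaviorTrajectory.bellman_iff`). Replacing `F` by `F₀` in this form only adds a symmetric
matrix to `D` (`offPolicyResidual_change_gain`). The loop of `F₀` is Schur stable after scaling by
`√γ`, so the new `D` is the Lyapunov image of some symmetric `V`. Adding `V`, with `E₁` and `E₂`, to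
the true solution for `F₀` gives another solution for `F₀`; excitation forces `V = E₁ = E₂ = 0`,
hence `D = 0`. So excitation at `F₀` makes every off-policy evaluation classical, for any gain
(`IsOffPolicyEvaluation.classical`).

What remains is classical policy iteration. Completing the square shows that the value of a gain is
a supersolution for the improved gain. Detectability then makes the improved gain stabilizing
(`isPowerStable_of_detectable`), and Lyapunov comparison makes the values decrease. Their limit
solves the Riccati equation, and the same comparison gives uniqueness. -/

/-! ### Eigenvalues and Schur stability -/

/-- The vector `a + i b` is a complex eigenvector of the real matrix `M` for the eigenvalue
`α + i β`, written in real terms. -/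
structure IsRealEigenpair {n : ℕ} (M : Matrix (Fin n) (Fin n) ℝ) (α β : ℝ) (a b : Fin n → ℝ) :
    Prop where
  re : M *ᵥ a = α • a - β • b
  im : M *ᵥ b = β • a + α • b
  ne_zero : a ≠ 0 ∨ b ≠ 0

theorem IsRealEigenpair.enorm_le {n : ℕ} {M : Matrix (Fin n) (Fin n) ℝ} {α β : ℝ}
    {a b : Fin n → ℝ} (h : IsRealEigenpair M α β a b) :
    (‖(⟨α, β⟩ : ℂ)‖₊ : ENNReal) ≤ matrixSpectralRadius M := by
  refine le_iSup₂_of_le (⟨α, β⟩ : ℂ) ?_ le_rfl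
  rw [spectrum.mem_iff, Matrix.isUnit_iff_isUnit_det, isUnit_iff_ne_zero, not_not,
    ← Matrix.exists_mulVec_eq_zero_iff]
  refine ⟨fun i => ⟨a i, b i⟩, ?_, ?_⟩
  · intro h0
    rcases h.ne_zero with h1 | h1
    · exact h1 (funext fun i => congrArg Complex.re (congrFun h0 i))
    · exact h1 (funext fun i => congrArg Complex.im (congrFun h0 i))
  · rw [Matrix.sub_mulVec, sub_eq_zero, Algebra.algebraMap_eq_smul_one, Matrix.smul_mulVec,
      Matrix.one_mulVec]
    funext i
    have h1 := congrFun h.re i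
    have h2 := congrFun h.im i
    simp only [mulVec, dotProduct, Pi.sub_apply, Pi.add_apply, Pi.smul_apply, smul_eq_mul]
      at h1 h2
    apply Complex.ext
    · simp [mulVec, dotProduct, h1]
    · simp [mulVec, dotProduct, h2]
      ring

theorem IsRealEigenpair.of_complex {n : ℕ} {M : Matrix (Fin n) (Fin n) ℝ} {z : ℂ}
    (hz : z ∈ spectrum ℂ (M.map (algebraMap ℝ ℂ))) :
    ∃ a b, IsRealEigenpair M z.re z.im a b := by
  rw [spectrum.mem_iff, Matrix.isUnit_iff_isUnit_det, isUnit_iff_ne_zero, not_not,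
    ← Matrix.exists_mulVec_eq_zero_iff] at hz
  obtain ⟨v, hv, hz⟩ := hz
  rw [Matrix.sub_mulVec, sub_eq_zero, Algebra.algebraMap_eq_smul_one, Matrix.smul_mulVec,
      Matrix.one_mulVec] at hz
  refine ⟨fun i => (v i).re, fun i => (v i).im, ?_, ?_, ?_⟩
  · funext i
    have h1 := congrArg Complex.re (congrFun hz i)
    simpa [mulVec, dotProduct] using h1.symm
  · funext i
    have h1 := congrArg Complex.im (congrFun hz i)
    simp [mulVec, dotProduct] at h1 ⊢
    linarith
  · by_contra! h
    apply hv
    funext i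
    exact Complex.ext (congrFun h.1 i) (congrFun h.2 i)

/-- Schur stability: the powers of the matrix tend to zero. -/
def IsPowerStable {n : ℕ} (M : Matrix (Fin n) (Fin n) ℝ) : Prop :=
  Tendsto (fun k => M ^ k) atTop (𝓝 0)

/-- By Gelfand's formula `‖a ^ k‖ ^ (1 / k)` is eventually below some `r < 1`. -/
theorem tendsto_pow_zero_of_spectralRadius_lt_one {E : Type*} [NormedRing E] [NormedAlgebra ℂ E]
    [CompleteSpace E] {a : E} (ha : spectralRadius ℂ a < 1) :
    Tendsto (fun k => a ^ k) atTop (𝓝 0) := by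
  obtain ⟨r, h1, h2⟩ := ENNReal.lt_iff_exists_nnreal_btwn.1 ha
  have hr : r < 1 := by exact_mod_cast h2
  have hev := (spectrum.pow_nnnorm_pow_one_div_tendsto_nhds_spectralRadius a).eventually_lt_const h1
  have hb : ∀ᶠ k : ℕ in atTop, ‖a ^ k‖ ≤ (r : ℝ) ^ k := by
    filter_upwards [hev, eventually_gt_atTop 0] with k hk hk0
    have hk' : (k : ℝ) ≠ 0 := by positivity
    have h3 := ENNReal.rpow_le_rpow hk.le (show (0 : ℝ) ≤ k by positivity)
    rw [← ENNReal.rpow_mul, one_div, inv_mul_cancel₀ hk', ENNReal.rpow_one,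
      ENNReal.rpow_natCast] at h3
    have h4 : ‖a ^ k‖₊ ≤ r ^ k := by exact_mod_cast h3
    exact_mod_cast h4
  exact squeeze_zero_norm' hb (tendsto_pow_atTop_nhds_zero_of_lt_one r.2 (by exact_mod_cast hr))

section
attribute [local instance] Matrix.linftyOpNormedRing Matrix.linftyOpNormedAlgebra
  Matrix.linftyOpNormedAddCommGroup

theorem isPowerStable_of_eigenpair {n : ℕ} {M : Matrix (Fin n) (Fin n) ℝ}
    (h : ∀ α β a b, IsRealEigenpair M α β a b → α ^ 2 + β ^ 2 < 1) : IsPowerStable M := by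
  rcases Nat.eq_zero_or_pos n with rfl | hn
  -- Dimension zero is separate: the strict bound on the spectral radius below needs a nonempty
  -- spectrum.
  · exact (tendsto_const_nhds (x := (0 : Matrix (Fin 0) (Fin 0) ℝ))).congr
      fun _ => Subsingleton.elim _ _
  have : Nonempty (Fin n) := ⟨⟨0, hn⟩⟩
  have hs : spectralRadius ℂ (M.map (algebraMap ℝ ℂ)) < ((1 : NNReal) : ENNReal) := by
    refine spectrum.spectralRadius_lt_of_forall_lt _ fun z hz => ?_
    obtain ⟨a, b, hab⟩ := IsRealEigenpair.of_complex hz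
    have h1 := h _ _ _ _ hab
    have h2 : ‖z‖ < 1 := by
      rw [Complex.norm_def, Real.sqrt_lt' one_pos, Complex.normSq_apply]
      linarith
    exact_mod_cast h2
  have ht := tendsto_pow_zero_of_spectralRadius_lt_one (by simpa using hs)
  refine tendsto_pi_nhds.2 fun i => tendsto_pi_nhds.2 fun j => ?_
  have h1 := (Complex.continuous_re.tendsto _).comp
    (((continuous_apply_apply i j).tendsto (0 : Matrix (Fin n) (Fin n) ℂ)).comp ht)
  refine Tendsto.congr (fun k => ?_) (by simpa using h1)
  have : M.map (algebraMap ℝ ℂ) ^ k = (M ^ k).map (algebraMap ℝ ℂ) :=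
    (map_pow (algebraMap ℝ ℂ).mapMatrix M k).symm
  exact (congrArg (fun N : Matrix (Fin n) (Fin n) ℂ => (N i j).re) this).trans (by simp)
end

theorem IsRealEigenpair.of_smul {n : ℕ} {M : Matrix (Fin n) (Fin n) ℝ} {c α β : ℝ} (hc : c ≠ 0)
    {a b : Fin n → ℝ} (h : IsRealEigenpair (c • M) α β a b) :
    IsRealEigenpair M (α / c) (β / c) a b := by
  have key : ∀ v, M *ᵥ v = c⁻¹ • ((c • M) *ᵥ v) := fun v => by
    rw [Matrix.smul_mulVec, smul_smul, inv_mul_cancel₀ hc, one_smul]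
  refine ⟨?_, ?_, h.ne_zero⟩
  · rw [key, h.re, smul_sub, smul_smul, smul_smul]
    ring_nf
  · rw [key, h.im, smul_add, smul_smul, smul_smul]
    ring_nf

theorem IsRealEigenpair.sq_lt_one {n : ℕ} {M : Matrix (Fin n) (Fin n) ℝ} {c α β : ℝ} (hc : 0 < c)
    (hc1 : c < 1) (hM : matrixSpectralRadius M ≤ 1)
    {a b : Fin n → ℝ} (h : IsRealEigenpair (c • M) α β a b) : α ^ 2 + β ^ 2 < 1 := by
  have h1 := (h.of_smul hc.ne').enorm_le.trans hM
  have h2 : ‖(⟨α / c, β / c⟩ : ℂ)‖ ≤ 1 := by exact_mod_cast h1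
  rw [Complex.norm_def, Real.sqrt_le_iff, Complex.normSq_apply] at h2
  replace h2 := h2.2
  simp only at h2
  have h3 : α / c * (α / c) + β / c * (β / c) = (α ^ 2 + β ^ 2) / c ^ 2 := by
    field_simp
  rw [h3, one_pow, div_le_one (by positivity)] at h2
  nlinarith

/-- A matrix of spectral radius at most one becomes Schur stable when scaled by `c < 1`. -/
theorem isPowerStable_smul {n : ℕ} {M : Matrix (Fin n) (Fin n) ℝ} {c : ℝ} (hc : 0 < c)
    (hc1 : c < 1) (hM : matrixSpectralRadius M ≤ 1) : IsPowerStable (c • M) :=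
  isPowerStable_of_eigenpair fun _ _ _ _ h => h.sq_lt_one hc hc1 hM

/-! ### Semidefiniteness and Lyapunov equations -/

theorem posSemidef_of_real {n : ℕ} {M : Matrix (Fin n) (Fin n) ℝ} (hs : M.IsSymm)
    (h : ∀ v, 0 ≤ v ⬝ᵥ M *ᵥ v) : M.PosSemidef :=
  .of_dotProduct_mulVec_nonneg (by rw [IsHermitian, conjTranspose_eq_transpose_of_trivial]; exact hs)
    (by simpa using h)

theorem Matrix.PosSemidef.isSymm {n : ℕ} {M : Matrix (Fin n) (Fin n) ℝ} (h : M.PosSemidef) :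
    M.IsSymm := by
  rw [IsSymm, ← conjTranspose_eq_transpose_of_trivial]; exact h.1

theorem Matrix.PosSemidef.quadForm_nonneg {n : ℕ} {M : Matrix (Fin n) (Fin n) ℝ} (h : M.PosSemidef)
    (v : Fin n → ℝ) : 0 ≤ v ⬝ᵥ M *ᵥ v := by
  simpa using h.dotProduct_mulVec_nonneg v

theorem Matrix.PosSemidef.transpose_mul_mul {n m : ℕ} {M : Matrix (Fin n) (Fin n) ℝ}
    (h : M.PosSemidef) (N : Matrix (Fin n) (Fin m) ℝ) : (Nᵀ * M * N).PosSemidef := by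
  simpa using h.conjTranspose_mul_mul_same N

theorem dotProduct_transpose_mul_mul {n m : ℕ} (M : Matrix (Fin n) (Fin n) ℝ)
    (N : Matrix (Fin n) (Fin m) ℝ) (v w : Fin m → ℝ) :
    v ⬝ᵥ (Nᵀ * M * N) *ᵥ w = (N *ᵥ v) ⬝ᵥ M *ᵥ (N *ᵥ w) := by
  rw [← Matrix.mulVec_mulVec, ← Matrix.mulVec_mulVec, Matrix.dotProduct_mulVec,
    Matrix.vecMul_transpose]

theorem IsPowerStable.tendsto_conj {n : ℕ} {M : Matrix (Fin n) (Fin n) ℝ} (hM : IsPowerStable M)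
    (D : Matrix (Fin n) (Fin n) ℝ) :
    Tendsto (fun k => (M ^ k)ᵀ * D * M ^ k) atTop (𝓝 0) := by
  have hc : Continuous fun N : Matrix (Fin n) (Fin n) ℝ => Nᵀ * D * N := by fun_prop
  have h := (hc.tendsto 0).comp hM
  simp only [transpose_zero, Matrix.zero_mul, Matrix.mul_zero] at h
  exact h

/-- Iterating gives `D = (M ^ k)' D M ^ k`, which tends to zero. -/
theorem IsPowerStable.eq_zero_of_eq_conj {n : ℕ} {M D : Matrix (Fin n) (Fin n) ℝ}
    (hM : IsPowerStable M) (hD : D = Mᵀ * D * M) : D = 0 := by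
  have h : ∀ k, (M ^ k)ᵀ * D * M ^ k = D := by
    intro k
    induction k with
    | zero => simp
    | succ k ih =>
      calc (M ^ (k + 1))ᵀ * D * M ^ (k + 1) = (M ^ k)ᵀ * (Mᵀ * D * M) * M ^ k := by
            rw [pow_succ', transpose_mul]; simp only [Matrix.mul_assoc]
        _ = D := by rw [← hD, ih]
  exact tendsto_nhds_unique (tendsto_const_nhds.congr fun k => (h k).symm) (hM.tendsto_conj D)

/-- The discrete Lyapunov equation of a Schur stable matrix is solvable. -/
theorem IsPowerStable.exists_lyapunov {n : ℕ} {M : Matrix (Fin n) (Fin n) ℝ}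
    (hM : IsPowerStable M) (S : Matrix (Fin n) (Fin n) ℝ) :
    ∃ X, X - Mᵀ * X * M = S := by
  let f : Matrix (Fin n) (Fin n) ℝ →ₗ[ℝ] Matrix (Fin n) (Fin n) ℝ :=
    { toFun := fun X => X - Mᵀ * X * M
      map_add' := fun X Y => by rw [Matrix.mul_add, Matrix.add_mul]; abel
      map_smul' := fun c X => by simp [smul_sub] }
  have hi : Function.Injective f := by
    rw [injective_iff_map_eq_zero]
    exact fun D hD => hM.eq_zero_of_eq_conj (sub_eq_zero.1 hD)
  exact LinearMap.injective_iff_surjective.1 hi S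

theorem IsPowerStable.lyapunov_unique {n : ℕ} {M X Y : Matrix (Fin n) (Fin n) ℝ}
    (hM : IsPowerStable M) (h : X - Mᵀ * X * M = Y - Mᵀ * Y * M) : X = Y := by
  refine sub_eq_zero.1 (hM.eq_zero_of_eq_conj ?_)
  rw [Matrix.mul_sub, Matrix.sub_mul]
  rw [sub_eq_sub_iff_add_eq_add] at h ⊢
  rw [h, add_comm]

/-- The transpose of `X` solves the same Lyapunov equation. -/
theorem IsPowerStable.lyapunov_isSymm {n : ℕ} {M X : Matrix (Fin n) (Fin n) ℝ}
    (hM : IsPowerStable M) (h : (X - Mᵀ * X * M).IsSymm) : X.IsSymm := by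
  refine hM.lyapunov_unique ?_
  rw [← h.eq]
  simp [Matrix.mul_assoc]

/-- Along the orbit of `v` the quadratic form of `X` decreases, and it tends to zero, so it starts
nonnegative. -/
theorem IsPowerStable.lyapunov_posSemidef {n : ℕ} {M X : Matrix (Fin n) (Fin n) ℝ}
    (hM : IsPowerStable M) (h : (X - Mᵀ * X * M).PosSemidef) : X.PosSemidef := by
  refine posSemidef_of_real (hM.lyapunov_isSymm h.isSymm) fun v => ?_
  have hk : ∀ k, v ⬝ᵥ ((M ^ k)ᵀ * X * M ^ k) *ᵥ v ≤ v ⬝ᵥ X *ᵥ v := by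
    intro k
    induction k with
    | zero => simp
    | succ k ih =>
      refine le_trans ?_ ih
      have h1 := h.quadForm_nonneg ((M ^ k) *ᵥ v)
      rw [Matrix.sub_mulVec, dotProduct_sub, dotProduct_transpose_mul_mul] at h1
      rw [dotProduct_transpose_mul_mul, dotProduct_transpose_mul_mul, pow_succ',
        ← Matrix.mulVec_mulVec]
      linarith
  have hc : Continuous fun N : Matrix (Fin n) (Fin n) ℝ => v ⬝ᵥ N *ᵥ v := by fun_prop
  have ht := (hc.tendsto 0).comp (hM.tendsto_conj X)
  simp only [zero_mulVec, dotProduct_zero] at ht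
  exact le_of_tendsto ht (Eventually.of_forall hk)

theorem smul_transpose_mul_mul_eq {n : ℕ} {γ : ℝ} (hγ : 0 ≤ γ) (N X : Matrix (Fin n) (Fin n) ℝ) :
    γ • (Nᵀ * X * N) = (√γ • N)ᵀ * X * (√γ • N) := by
  simp [smul_smul, Real.mul_self_sqrt hγ]

/-! ### Policy evaluation and detectability -/

/-- The classical policy evaluation equation, in discounted form, for the gain `F`. -/
def SolvesPolicyEvaluation {n m : ℕ} (A : Matrix (Fin n) (Fin n) ℝ) (B : Matrix (Fin n) (Fin m) ℝ)
    (Q : Matrix (Fin n) (Fin n) ℝ) (R : Matrix (Fin m) (Fin m) ℝ) (γ : ℝ)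
    (F : Matrix (Fin m) (Fin n) ℝ) (X : Matrix (Fin n) (Fin n) ℝ) : Prop :=
  X = γ • ((A + B * F)ᵀ * X * (A + B * F)) + Fᵀ * R * F + Q

/-- Real form of `(Mv)* X (Mv) = |λ|² v* X v` for a complex eigenvector `v = a + i b`. -/
theorem quadForm_eigen {n : ℕ} (X : Matrix (Fin n) (Fin n) ℝ) (α β : ℝ) (a b : Fin n → ℝ) :
    (α • a - β • b) ⬝ᵥ X *ᵥ (α • a - β • b) + (β • a + α • b) ⬝ᵥ X *ᵥ (β • a + α • b)
      = (α ^ 2 + β ^ 2) * (a ⬝ᵥ X *ᵥ a + b ⬝ᵥ X *ᵥ b) := by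
  simp only [mulVec_sub, mulVec_add, mulVec_smul, dotProduct_sub, dotProduct_add, sub_dotProduct,
    add_dotProduct, dotProduct_smul, smul_dotProduct, smul_eq_mul]
  ring

theorem Matrix.PosDef.eq_zero_of_quadForm_nonpos {m : ℕ} {R : Matrix (Fin m) (Fin m) ℝ}
    (hR : R.PosDef) {v : Fin m → ℝ} (h : v ⬝ᵥ R *ᵥ v ≤ 0) : v = 0 := by
  by_contra hv
  have := hR.dotProduct_mulVec_pos hv
  simp only [star_trivial] at this
  linarith

/-- A detectable system is stabilized, after discounting, by every gain which has a positive
semidefinite value supersolution. -/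
theorem isPowerStable_of_detectable {n m p : ℕ} {A : Matrix (Fin n) (Fin n) ℝ}
    {B : Matrix (Fin n) (Fin m) ℝ} {R : Matrix (Fin m) (Fin m) ℝ} {C : Matrix (Fin n) (Fin p) ℝ}
    {c : ℝ} (hc : 0 < c) (hc1 : c < 1) (hR : R.PosDef) (hdet : IsDetectable A Cᵀ)
    {F : Matrix (Fin m) (Fin n) ℝ} {X : Matrix (Fin n) (Fin n) ℝ} (hX : X.PosSemidef)
    (h : (X - (c • (A + B * F))ᵀ * X * (c • (A + B * F)) - (Fᵀ * R * F + C * Cᵀ)).PosSemidef) :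
    IsPowerStable (c • (A + B * F)) := by
  obtain ⟨L, hL⟩ := hdet
  refine isPowerStable_of_eigenpair fun α β a b hab => ?_
  by_contra! hge
  have hC : C * Cᵀ = (Cᵀ)ᵀ * (1 : Matrix (Fin p) (Fin p) ℝ) * Cᵀ := by simp
  have key : ∀ v, (F *ᵥ v) ⬝ᵥ R *ᵥ (F *ᵥ v) + (Cᵀ *ᵥ v) ⬝ᵥ (Cᵀ *ᵥ v)
      ≤ v ⬝ᵥ X *ᵥ v - ((c • (A + B * F)) *ᵥ v) ⬝ᵥ X *ᵥ ((c • (A + B * F)) *ᵥ v) := fun v => by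
    have := h.quadForm_nonneg v
    rw [Matrix.sub_mulVec, Matrix.sub_mulVec, Matrix.add_mulVec, dotProduct_sub, dotProduct_sub,
      dotProduct_add, dotProduct_transpose_mul_mul, dotProduct_transpose_mul_mul, hC,
      dotProduct_transpose_mul_mul, Matrix.one_mulVec] at this
    linarith
  have ka := key a
  have kb := key b
  rw [hab.re] at ka
  rw [hab.im] at kb
  have hq := quadForm_eigen X α β a b
  -- With `|λ| ≥ 1`, the right sides of `ka` and `kb` add up to `(1 - |λ|²) v* X v ≤ 0`, so every
  -- nonnegative term on the left vanishes.
  have h0 : (α ^ 2 + β ^ 2) * (a ⬝ᵥ X *ᵥ a + b ⬝ᵥ X *ᵥ b) ≥ a ⬝ᵥ X *ᵥ a + b ⬝ᵥ X *ᵥ b :=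
    le_mul_of_one_le_left (add_nonneg (hX.quadForm_nonneg a) (hX.quadForm_nonneg b)) hge
  have ra := hR.posSemidef.quadForm_nonneg (F *ᵥ a)
  have rb := hR.posSemidef.quadForm_nonneg (F *ᵥ b)
  have dnn : ∀ v : Fin p → ℝ, 0 ≤ v ⬝ᵥ v := fun v => by simpa using dotProduct_star_self_nonneg v
  have ca := dnn (Cᵀ *ᵥ a)
  have cb := dnn (Cᵀ *ᵥ b)
  have hFa : F *ᵥ a = 0 := hR.eq_zero_of_quadForm_nonpos (by linarith)
  have hFb : F *ᵥ b = 0 := hR.eq_zero_of_quadForm_nonpos (by linarith)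
  have hCa : Cᵀ *ᵥ a = 0 := dotProduct_self_eq_zero.1 (by linarith)
  have hCb : Cᵀ *ᵥ b = 0 := dotProduct_self_eq_zero.1 (by linarith)
  -- Both loops act as `c • A` on the common kernel of `F` and `Cᵀ`, so the bad eigenpair passes to
  -- the stable matrix `c • (A + L * Cᵀ)`.
  have hsame : ∀ v, F *ᵥ v = 0 → Cᵀ *ᵥ v = 0 →
      (c • (A + L * Cᵀ)) *ᵥ v = (c • (A + B * F)) *ᵥ v := fun v h1 h2 => by
    simp only [Matrix.smul_mulVec, Matrix.add_mulVec, ← Matrix.mulVec_mulVec, h1, h2,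
      Matrix.mulVec_zero]
  have hab' : IsRealEigenpair (c • (A + L * Cᵀ)) α β a b :=
    ⟨(hsame a hFa hCa).trans hab.re, (hsame b hFb hCb).trans hab.im, hab.ne_zero⟩
  exact absurd (hab'.sq_lt_one hc hc1 hL.le) (not_lt.2 hge)

/-! ### Classical policy iteration and the Riccati equation -/

section Control

variable {n m : ℕ} {A : Matrix (Fin n) (Fin n) ℝ} {B : Matrix (Fin n) (Fin m) ℝ}
  {Q : Matrix (Fin n) (Fin n) ℝ} {R : Matrix (Fin m) (Fin m) ℝ} {γ : ℝ}

theorem posDef_add_smul_conj (hγ : 0 ≤ γ) (hR : R.PosDef) {X : Matrix (Fin n) (Fin n) ℝ}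
    (hX : X.PosSemidef) : (R + γ • (Bᵀ * X * B)).PosDef :=
  hR.add_posSemidef ((hX.transpose_mul_mul B).smul hγ)

theorem mul_gainOf (hγ : 0 ≤ γ) (hR : R.PosDef) {X : Matrix (Fin n) (Fin n) ℝ}
    (hX : X.PosSemidef) :
    (R + γ • (Bᵀ * X * B)) * gainOf A B R γ X = -(γ • (Bᵀ * X * A)) := by
  have hu := (Matrix.isUnit_iff_isUnit_det _).1 (posDef_add_smul_conj (B := B) hγ hR hX).isUnit
  rw [gainOf, improvedGain, Matrix.mul_neg, Matrix.mul_smul, ← Matrix.mul_assoc,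
    Matrix.mul_nonsing_inv _ hu, Matrix.one_mul]

/-- Completion of the square in the Bellman operator around the improved gain. -/
theorem bellman_complete_square (hγ : 0 ≤ γ) (hR : R.PosDef) {X : Matrix (Fin n) (Fin n) ℝ}
    (hX : X.PosSemidef) (F : Matrix (Fin m) (Fin n) ℝ) :
    γ • ((A + B * F)ᵀ * X * (A + B * F)) + Fᵀ * R * F + Q
      = (Q + γ • (Aᵀ * X * A)
        - γ ^ 2 • (Aᵀ * X * B * (R + γ • (Bᵀ * X * B))⁻¹ * (Bᵀ * X * A)))
        + (F - gainOf A B R γ X)ᵀ * (R + γ • (Bᵀ * X * B)) * (F - gainOf A B R γ X) := by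
  have hS := posDef_add_smul_conj (B := B) hγ hR hX
  have h1 := mul_gainOf (A := A) (B := B) hγ hR hX
  have h2 : (gainOf A B R γ X)ᵀ * (R + γ • (Bᵀ * X * B)) = -(γ • (Aᵀ * X * B)) := by
    have := congrArg transpose h1
    rw [transpose_mul, hS.posSemidef.isSymm.eq] at this
    rw [this]
    simp [hX.isSymm.eq, Matrix.mul_assoc]
  have h3 : γ ^ 2 • (Aᵀ * X * B * (R + γ • (Bᵀ * X * B))⁻¹ * (Bᵀ * X * A))
      = -(γ • (Aᵀ * X * B)) * gainOf A B R γ X := by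
    rw [gainOf, improvedGain]
    simp [Matrix.mul_assoc, smul_smul, sq]
  rw [h3]
  -- Only the normal equations `h1` and `h2` of the gain are used from here on.
  generalize gainOf A B R γ X = G at *
  rw [Matrix.mul_sub, transpose_sub, Matrix.sub_mul, Matrix.sub_mul, Matrix.sub_mul, h2,
    Matrix.mul_assoc Fᵀ _ G, h1]
  simp only [transpose_add, transpose_mul, Matrix.add_mul, Matrix.mul_add, smul_add, Matrix.neg_mul,
    Matrix.mul_neg, Matrix.mul_smul, Matrix.smul_mul, Matrix.mul_assoc]
  abel

/-- The completed square vanishes at the improved gain. -/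
theorem solvesARE_iff (hγ : 0 ≤ γ) (hR : R.PosDef) {X : Matrix (Fin n) (Fin n) ℝ}
    (hX : X.PosSemidef) :
    SolvesARE A B Q R γ X ↔ SolvesPolicyEvaluation A B Q R γ (gainOf A B R γ X) X := by
  rw [SolvesARE, SolvesPolicyEvaluation, bellman_complete_square hγ hR hX]
  simp

/-- The gain `F` is stabilizing for the discounted system. -/
def IsDiscountStabilizing (A : Matrix (Fin n) (Fin n) ℝ) (B : Matrix (Fin n) (Fin m) ℝ) (γ : ℝ)
    (F : Matrix (Fin m) (Fin n) ℝ) : Prop :=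
  IsPowerStable (√γ • (A + B * F))

theorem SolvesPolicyEvaluation.sub_eq (hγ : 0 ≤ γ) {F : Matrix (Fin m) (Fin n) ℝ}
    {X : Matrix (Fin n) (Fin n) ℝ} (h : SolvesPolicyEvaluation A B Q R γ F X) :
    X - (√γ • (A + B * F))ᵀ * X * (√γ • (A + B * F)) = Fᵀ * R * F + Q := by
  rw [← smul_transpose_mul_mul_eq hγ, sub_eq_iff_eq_add']
  nth_rw 1 [h]
  rw [add_assoc]

theorem solvesPolicyEvaluation_of_sub_eq (hγ : 0 ≤ γ) {F : Matrix (Fin m) (Fin n) ℝ}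
    {X : Matrix (Fin n) (Fin n) ℝ}
    (h : X - (√γ • (A + B * F))ᵀ * X * (√γ • (A + B * F)) = Fᵀ * R * F + Q) :
    SolvesPolicyEvaluation A B Q R γ F X := by
  rw [← smul_transpose_mul_mul_eq hγ, sub_eq_iff_eq_add'] at h
  rw [SolvesPolicyEvaluation, add_assoc]
  exact h

theorem posSemidef_stageCost (hQ : Q.PosSemidef) (hR : R.PosDef) (F : Matrix (Fin m) (Fin n) ℝ) :
    (Fᵀ * R * F + Q).PosSemidef :=
  (hR.posSemidef.transpose_mul_mul F).add hQ

theorem IsDiscountStabilizing.exists_value (hγ : 0 ≤ γ) {F : Matrix (Fin m) (Fin n) ℝ}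
    (hF : IsDiscountStabilizing A B γ F) : ∃ X, SolvesPolicyEvaluation A B Q R γ F X := by
  obtain ⟨X, hX⟩ := hF.exists_lyapunov (Fᵀ * R * F + Q)
  exact ⟨X, solvesPolicyEvaluation_of_sub_eq hγ hX⟩

theorem SolvesPolicyEvaluation.posSemidef (hγ : 0 ≤ γ) (hQ : Q.PosSemidef) (hR : R.PosDef)
    {F : Matrix (Fin m) (Fin n) ℝ} {X : Matrix (Fin n) (Fin n) ℝ}
    (h : SolvesPolicyEvaluation A B Q R γ F X) (hF : IsDiscountStabilizing A B γ F) :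
    X.PosSemidef := by
  refine hF.lyapunov_posSemidef ?_
  rw [h.sub_eq hγ]
  exact posSemidef_stageCost hQ hR F

theorem SolvesPolicyEvaluation.unique (hγ : 0 ≤ γ) {F : Matrix (Fin m) (Fin n) ℝ}
    {X Y : Matrix (Fin n) (Fin n) ℝ} (hX : SolvesPolicyEvaluation A B Q R γ F X)
    (hY : SolvesPolicyEvaluation A B Q R γ F Y) (hF : IsDiscountStabilizing A B γ F) : X = Y :=
  hF.lyapunov_unique (by rw [hX.sub_eq hγ, hY.sub_eq hγ])

/-- The value of a gain, written relative to the improved gain. -/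
theorem SolvesPolicyEvaluation.sub_eq_improved (hγ : 0 ≤ γ) (hR : R.PosDef)
    {F : Matrix (Fin m) (Fin n) ℝ} {X : Matrix (Fin n) (Fin n) ℝ}
    (h : SolvesPolicyEvaluation A B Q R γ F X) (hX : X.PosSemidef) (K : Matrix (Fin m) (Fin n) ℝ) :
    X - (√γ • (A + B * K))ᵀ * X * (√γ • (A + B * K))
      = Kᵀ * R * K + Q
        + ((F - gainOf A B R γ X)ᵀ * (R + γ • (Bᵀ * X * B)) * (F - gainOf A B R γ X)
        - (K - gainOf A B R γ X)ᵀ * (R + γ • (Bᵀ * X * B)) * (K - gainOf A B R γ X)) := by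
  have h1 := bellman_complete_square (A := A) (B := B) (Q := Q) hγ hR hX F
  have h2 := bellman_complete_square (A := A) (B := B) (Q := Q) hγ hR hX K
  rw [← smul_transpose_mul_mul_eq hγ, sub_eq_iff_eq_add']
  refine (Eq.trans h h1).trans ?_
  rw [eq_sub_of_add_eq h2.symm]
  abel

theorem posSemidef_gain_gap (hγ : 0 ≤ γ) (hR : R.PosDef) {X : Matrix (Fin n) (Fin n) ℝ}
    (hX : X.PosSemidef) (K : Matrix (Fin m) (Fin n) ℝ) :
    (Kᵀ * (R + γ • (Bᵀ * X * B)) * K).PosSemidef :=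
  (posDef_add_smul_conj hγ hR hX).posSemidef.transpose_mul_mul K

/-- At the improved gain the subtracted square vanishes and the other is semidefinite, so `X` is a
value supersolution there. -/
theorem SolvesPolicyEvaluation.improved_stabilizing {p : ℕ} {C : Matrix (Fin n) (Fin p) ℝ}
    (hγ₀ : 0 < γ) (hγ₁ : γ < 1) (hR : R.PosDef) (hC : C * Cᵀ = Q) (hdet : IsDetectable A Cᵀ)
    {F : Matrix (Fin m) (Fin n) ℝ} {X : Matrix (Fin n) (Fin n) ℝ}
    (h : SolvesPolicyEvaluation A B Q R γ F X) (hX : X.PosSemidef) :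
    IsDiscountStabilizing A B γ (gainOf A B R γ X) := by
  refine isPowerStable_of_detectable (R := R) (Real.sqrt_pos.2 hγ₀)
    ((Real.sqrt_lt' one_pos).2 (by simpa)) hR hdet hX ?_
  rw [h.sub_eq_improved hγ₀.le hR hX, hC]
  simpa using posSemidef_gain_gap hγ₀.le hR hX (F - gainOf A B R γ X)

/-- `X - Y` solves a Lyapunov equation of the improved loop whose right side is the remaining
square. -/
theorem SolvesPolicyEvaluation.improved_le (hγ : 0 ≤ γ) (hR : R.PosDef)
    {F : Matrix (Fin m) (Fin n) ℝ} {X Y : Matrix (Fin n) (Fin n) ℝ}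
    (hX : SolvesPolicyEvaluation A B Q R γ F X) (hX0 : X.PosSemidef)
    (hY : SolvesPolicyEvaluation A B Q R γ (gainOf A B R γ X) Y)
    (hs : IsDiscountStabilizing A B γ (gainOf A B R γ X)) : (X - Y).PosSemidef := by
  refine hs.lyapunov_posSemidef ?_
  have h1 := hX.sub_eq_improved hγ hR hX0 (gainOf A B R γ X)
  have h2 := hY.sub_eq hγ
  rw [Matrix.mul_sub, Matrix.sub_mul, sub_sub_sub_comm, h1, h2]
  simpa using posSemidef_gain_gap hγ hR hX0 (F - gainOf A B R γ X)

theorem Matrix.PosSemidef.eq_of_sub_of_sub {X Y : Matrix (Fin n) (Fin n) ℝ}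
    (h : (X - Y).PosSemidef) (h' : (Y - X).PosSemidef) : X = Y := by
  open scoped MatrixOrder in
  exact le_antisymm (Matrix.le_iff.2 h') (Matrix.le_iff.2 h)

/-- A solution whose gain is stabilizing is maximal: along the loop of `Y`, the Lyapunov image of `Y
- X` is a square. -/
theorem SolvesARE.sub_posSemidef (hγ : 0 ≤ γ) (hR : R.PosDef)
    {X Y : Matrix (Fin n) (Fin n) ℝ} (hX : X.PosSemidef) (hY : Y.PosSemidef)
    (h : SolvesARE A B Q R γ X) (h' : SolvesARE A B Q R γ Y)
    (hs : IsDiscountStabilizing A B γ (gainOf A B R γ Y)) : (Y - X).PosSemidef := by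
  refine hs.lyapunov_posSemidef ?_
  have h1 := ((solvesARE_iff hγ hR hX).1 h).sub_eq_improved hγ hR hX (gainOf A B R γ Y)
  have h2 := ((solvesARE_iff hγ hR hY).1 h').sub_eq hγ
  rw [Matrix.mul_sub, Matrix.sub_mul, sub_sub_sub_comm, h1, h2]
  simpa using posSemidef_gain_gap hγ hR hX (gainOf A B R γ Y - gainOf A B R γ X)

/-- Detectability makes the gains of both solutions stabilizing, so each solution dominates the
other. -/
theorem SolvesARE.unique {p : ℕ} {C : Matrix (Fin n) (Fin p) ℝ}
    (hγ₀ : 0 < γ) (hγ₁ : γ < 1) (hR : R.PosDef) (hC : C * Cᵀ = Q) (hdet : IsDetectable A Cᵀ)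
    {X Y : Matrix (Fin n) (Fin n) ℝ} (hX : X.PosSemidef) (hY : Y.PosSemidef)
    (h : SolvesARE A B Q R γ X) (h' : SolvesARE A B Q R γ Y) : X = Y :=
  Matrix.PosSemidef.eq_of_sub_of_sub
    (h'.sub_posSemidef hγ₀.le hR hY hX h
      (((solvesARE_iff hγ₀.le hR hX).1 h).improved_stabilizing hγ₀ hγ₁ hR hC hdet hX))
    (h.sub_posSemidef hγ₀.le hR hX hY h'
      (((solvesARE_iff hγ₀.le hR hY).1 h').improved_stabilizing hγ₀ hγ₁ hR hC hdet hY))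

/-- A decreasing sequence of positive semidefinite matrices converges. -/
theorem exists_tendsto_of_posSemidef_antitone {X : ℕ → Matrix (Fin n) (Fin n) ℝ}
    (h0 : ∀ s, (X s).PosSemidef) (hmono : ∀ s, (X s - X (s + 1)).PosSemidef) :
    ∃ Y : Matrix (Fin n) (Fin n) ℝ, Y.PosSemidef ∧ Tendsto X atTop (𝓝 Y) := by
  have hq : ∀ v, ∃ l, Tendsto (fun s => v ⬝ᵥ X s *ᵥ v) atTop (𝓝 l) := fun v => by
    refine ⟨_, tendsto_atTop_ciInf (antitone_nat_of_succ_le fun s => ?_) ⟨0, ?_⟩⟩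
    · have := (hmono s).quadForm_nonneg v
      rw [Matrix.sub_mulVec, dotProduct_sub] at this
      linarith
    · rintro _ ⟨s, rfl⟩
      exact (h0 s).quadForm_nonneg v
  choose q hq using hq
  -- Polarization recovers the entries from the convergent quadratic forms.
  have hpol : ∀ s i j, X s i j = ((Pi.single i 1 + Pi.single j 1 : Fin n → ℝ) ⬝ᵥ
      X s *ᵥ (Pi.single i 1 + Pi.single j 1) - (Pi.single i 1 : Fin n → ℝ) ⬝ᵥ X s *ᵥ Pi.single i 1
      - (Pi.single j 1 : Fin n → ℝ) ⬝ᵥ X s *ᵥ Pi.single j 1) / 2 := fun s i j => by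
    have := (h0 s).isSymm.apply i j
    simp [Matrix.mulVec_add, this]
    ring
  have ht : Tendsto X atTop (𝓝 (Matrix.of fun i j => (q (Pi.single i 1 + Pi.single j 1)
      - q (Pi.single i 1) - q (Pi.single j 1)) / 2)) := by
    refine tendsto_pi_nhds.2 fun i => tendsto_pi_nhds.2 fun j => ?_
    exact ((((hq _).sub (hq _)).sub (hq _)).div_const 2).congr fun s => (hpol s i j).symm
  refine ⟨_, posSemidef_of_real ?_ fun v => ?_, ht⟩
  · have hc : Continuous fun N : Matrix (Fin n) (Fin n) ℝ => Nᵀ := by fun_prop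
    exact tendsto_nhds_unique (((hc.tendsto _).comp ht).congr fun s => (h0 s).isSymm.eq) ht
  · have hc : Continuous fun N : Matrix (Fin n) (Fin n) ℝ => v ⬝ᵥ N *ᵥ v := by fun_prop
    exact ge_of_tendsto ((hc.tendsto _).comp ht)
      (Eventually.of_forall fun s => (h0 s).quadForm_nonneg v)

theorem Matrix.continuousAt_inv_of_isUnit {S : Matrix (Fin m) (Fin m) ℝ} (hS : IsUnit S) :
    ContinuousAt Inv.inv S := by
  have hdet := ((Matrix.isUnit_iff_isUnit_det _).1 hS).ne_zero
  refine continuousAt_matrix_inv _ ?_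
  rw [Ring.inverse_eq_inv']
  exact continuousAt_inv₀ hdet

theorem tendsto_improvedGain {S : ℕ → Matrix (Fin m) (Fin m) ℝ} {N : ℕ → Matrix (Fin m) (Fin n) ℝ}
    {S' : Matrix (Fin m) (Fin m) ℝ} {N' : Matrix (Fin m) (Fin n) ℝ}
    (hu : IsUnit (R + γ • S')) (hS : Tendsto S atTop (𝓝 S')) (hN : Tendsto N atTop (𝓝 N')) :
    Tendsto (fun s => improvedGain R γ (N s) (S s)) atTop (𝓝 (improvedGain R γ N' S')) := by
  have h1 : Tendsto (fun s => R + γ • S s) atTop (𝓝 (R + γ • S')) := (hS.const_smul γ).const_add R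
  have h2 : Tendsto (fun s => (R + γ • S s)⁻¹) atTop (𝓝 (R + γ • S')⁻¹) :=
    (Matrix.continuousAt_inv_of_isUnit hu).tendsto.comp h1
  have hc : Continuous fun N : Matrix (Fin m) (Fin m) ℝ × Matrix (Fin m) (Fin n) ℝ =>
    -(γ • (N.1 * N.2)) := by fun_prop
  have h := (hc.tendsto ((R + γ • S')⁻¹, N')).comp (h2.prodMk_nhds hN)
  simpa only [improvedGain, Function.comp_def] using h

theorem tendsto_gainOf (hγ : 0 ≤ γ) (hR : R.PosDef) {X : ℕ → Matrix (Fin n) (Fin n) ℝ}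
    {Y : Matrix (Fin n) (Fin n) ℝ} (hY : Y.PosSemidef) (h : Tendsto X atTop (𝓝 Y)) :
    Tendsto (fun s => gainOf A B R γ (X s)) atTop (𝓝 (gainOf A B R γ Y)) := by
  have h1 : Continuous fun N : Matrix (Fin n) (Fin n) ℝ => Bᵀ * N * B := by fun_prop
  have h2 : Continuous fun N : Matrix (Fin n) (Fin n) ℝ => Bᵀ * N * A := by fun_prop
  exact tendsto_improvedGain (posDef_add_smul_conj hγ hR hY).isUnit ((h1.tendsto Y).comp h)
    ((h2.tendsto Y).comp h)

/-- Convergence of classical policy iteration. -/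
theorem policyIteration_converges (hγ : 0 ≤ γ) (hQ : Q.PosSemidef) (hR : R.PosDef)
    {F : ℕ → Matrix (Fin m) (Fin n) ℝ} {X : ℕ → Matrix (Fin n) (Fin n) ℝ}
    (hF : ∀ s, IsDiscountStabilizing A B γ (F s))
    (hX : ∀ s, SolvesPolicyEvaluation A B Q R γ (F s) (X s))
    (hstep : ∀ s, F (s + 1) = gainOf A B R γ (X s)) :
    ∃ Y : Matrix (Fin n) (Fin n) ℝ, Y.PosSemidef ∧ SolvesARE A B Q R γ Y ∧
      Tendsto X atTop (𝓝 Y) ∧ Tendsto F atTop (𝓝 (gainOf A B R γ Y)) := by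
  have h0 : ∀ s, (X s).PosSemidef := fun s => (hX s).posSemidef hγ hQ hR (hF s)
  obtain ⟨Y, hY, hlim⟩ := exists_tendsto_of_posSemidef_antitone h0 fun s => by
    have h1 := hX (s + 1)
    have h2 := hF (s + 1)
    rw [hstep] at h1 h2
    exact (hX s).improved_le hγ hR (h0 s) h1 h2
  have hFlim : Tendsto F atTop (𝓝 (gainOf A B R γ Y)) := by
    rw [← tendsto_add_atTop_iff_nat 1]
    exact (tendsto_gainOf hγ hR hY hlim).congr fun s => (hstep s).symm
  refine ⟨Y, hY, (solvesARE_iff hγ hR hY).2 ?_, hlim, hFlim⟩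
  -- Passing to the limit in the evaluation equations makes `Y` the value of its own improved gain.
  have hc : Continuous fun N : Matrix (Fin m) (Fin n) ℝ × Matrix (Fin n) (Fin n) ℝ =>
      γ • ((A + B * N.1)ᵀ * N.2 * (A + B * N.1)) + N.1ᵀ * R * N.1 + Q := by fun_prop
  exact tendsto_nhds_unique hlim
    (((hc.tendsto _).comp (hFlim.prodMk_nhds hlim)).congr fun s => (hX s).symm)

end Control

/-! ### Quadratic forms and second moments -/

theorem dotProduct_transpose_mulVec' {n m : ℕ} (N : Matrix (Fin n) (Fin m) ℝ) (v : Fin m → ℝ)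
    (w : Fin n → ℝ) : v ⬝ᵥ Nᵀ *ᵥ w = (N *ᵥ v) ⬝ᵥ w := by
  rw [Matrix.dotProduct_mulVec, Matrix.vecMul_transpose]

theorem Matrix.IsSymm.dotProduct_mulVec_comm {n : ℕ} {X : Matrix (Fin n) (Fin n) ℝ}
    (h : X.IsSymm) (v w : Fin n → ℝ) : v ⬝ᵥ X *ᵥ w = w ⬝ᵥ X *ᵥ v := by
  conv_lhs => rw [← h.eq, dotProduct_transpose_mulVec', dotProduct_comm]

section Moments

variable {n m : ℕ} {Ω : Type*} [MeasurableSpace Ω] {P : Measure Ω}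

theorem MeasureTheory.MemLp.matrix_mulVec {y : Ω → Fin n → ℝ} (hy : MemLp y 2 P)
    (M : Matrix (Fin m) (Fin n) ℝ) : MemLp (fun ω => M *ᵥ y ω) 2 P := by
  rw [memLp_pi_iff] at hy ⊢
  intro i
  simp only [mulVec, dotProduct]
  exact memLp_finsetSum _ fun j _ => (hy j).const_mul (M i j)

theorem dotProduct_mulVec_eq_sum (M : Matrix (Fin m) (Fin n) ℝ) (v : Fin m → ℝ) (w : Fin n → ℝ) :
    v ⬝ᵥ M *ᵥ w = ∑ i, ∑ j, M i j * (v i * w j) := by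
  simp only [dotProduct, mulVec, Finset.mul_sum]
  exact Finset.sum_congr rfl fun i _ => Finset.sum_congr rfl fun j _ => by ring

theorem integrable_dotProduct_mulVec {y : Ω → Fin m → ℝ} {z : Ω → Fin n → ℝ} (hy : MemLp y 2 P)
    (hz : MemLp z 2 P) (M : Matrix (Fin m) (Fin n) ℝ) :
    Integrable (fun ω => y ω ⬝ᵥ M *ᵥ z ω) P := by
  rw [memLp_pi_iff] at hy hz
  simp only [dotProduct_mulVec_eq_sum]
  exact integrable_finsetSum _ fun i _ => integrable_finsetSum _ fun j _ =>
    ((hy i).integrable_mul (hz j)).const_mul _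

theorem integral_dotProduct_mulVec {y : Ω → Fin m → ℝ} {z : Ω → Fin n → ℝ} (hy : MemLp y 2 P)
    (hz : MemLp z 2 P) (M : Matrix (Fin m) (Fin n) ℝ) :
    ∫ ω, y ω ⬝ᵥ M *ᵥ z ω ∂P = ∑ i, ∑ j, M i j * ∫ ω, y ω i * z ω j ∂P := by
  rw [memLp_pi_iff] at hy hz
  simp only [dotProduct_mulVec_eq_sum]
  have hi : ∀ i j, Integrable (fun ω => M i j * (y ω i * z ω j)) P := fun i j =>
    ((hy i).integrable_mul (hz j)).const_mul _
  rw [integral_finsetSum _ fun i _ => integrable_finsetSum _ fun j _ => hi i j]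
  refine Finset.sum_congr rfl fun i _ => ?_
  rw [integral_finsetSum _ fun j _ => hi i j]
  exact Finset.sum_congr rfl fun j _ => integral_const_mul _ _

theorem memLp_of_hasLaw_gaussian {W : Matrix (Fin n) (Fin n) ℝ} {w : Ω → Fin n → ℝ}
    (h : HasLaw (fun ω => WithLp.toLp 2 (w ω)) (multivariateGaussian 0 W) P) : MemLp w 2 P := by
  rw [memLp_pi_iff]
  intro i
  have h1 : MemLp (fun y : EuclideanSpace ℝ (Fin n) => y i) 2 (multivariateGaussian 0 W) :=
    (EuclideanSpace.proj i : EuclideanSpace ℝ (Fin n) →L[ℝ] ℝ).comp_memLp'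
      (IsGaussian.memLp_two_id (μ := multivariateGaussian 0 W))
  rw [← h.map_eq] at h1
  exact h1.comp_of_map h.aemeasurable

theorem integral_of_hasLaw_gaussian {W : Matrix (Fin n) (Fin n) ℝ} {w : Ω → Fin n → ℝ}
    (h : HasLaw (fun ω => WithLp.toLp 2 (w ω)) (multivariateGaussian 0 W) P) (i : Fin n) :
    ∫ ω, w ω i ∂P = 0 := by
  have h1 : ∫ y : EuclideanSpace ℝ (Fin n), y i ∂(multivariateGaussian 0 W) = 0 := by
    have := (EuclideanSpace.proj i : EuclideanSpace ℝ (Fin n) →L[ℝ] ℝ).integral_comp_comm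
      (IsGaussian.integrable_id (μ := multivariateGaussian 0 W))
    simpa using this
  rw [← h1, ← h.integral_comp (f := fun y : EuclideanSpace ℝ (Fin n) => y i)
    (Measurable.aestronglyMeasurable (by fun_prop))]
  rfl

theorem integral_mul_of_hasLaw_gaussian {W : Matrix (Fin n) (Fin n) ℝ} (hW : W.PosSemidef)
    [IsProbabilityMeasure P] {w : Ω → Fin n → ℝ}
    (h : HasLaw (fun ω => WithLp.toLp 2 (w ω)) (multivariateGaussian 0 W) P) (i j : Fin n) :
    ∫ ω, w ω i * w ω j ∂P = W i j := by
  have hL := memLp_pi_iff.1 (memLp_of_hasLaw_gaussian h)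
  have h2 := covariance_eq_sub (hL i) (hL j)
  have h3 := h.covariance_fun_comp (f := fun y : EuclideanSpace ℝ (Fin n) => y i)
    (g := fun y : EuclideanSpace ℝ (Fin n) => y j) (by fun_prop) (by fun_prop)
  rw [covariance_eval_multivariateGaussian hW] at h3
  simp only [integral_of_hasLaw_gaussian h, mul_zero, sub_zero] at h2
  exact h2.symm.trans h3

end Moments

/-! ### The behavior trajectory -/

namespace IsBehaviorTrajectory

variable {n m : ℕ} {Ω : Type*} [MeasurableSpace Ω] {P : Measure Ω}
  {A : Matrix (Fin n) (Fin n) ℝ} {B : Matrix (Fin n) (Fin m) ℝ} {W : Matrix (Fin n) (Fin n) ℝ}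
  {x : ℕ → Ω → (Fin n → ℝ)} {u : ℕ → Ω → (Fin m → ℝ)} {w : ℕ → Ω → (Fin n → ℝ)}

theorem memLp_state (h : IsBehaviorTrajectory P A B W x u w) (k : ℕ) : MemLp (x k) 2 P := by
  induction k with
  | zero => exact h.memLp_init
  | succ k ih =>
    rw [show x (k + 1) = fun ω => A *ᵥ x k ω + B *ᵥ u k ω + w k ω from funext (h.dynamics k)]
    exact ((ih.matrix_mulVec A).add ((h.memLp_input k).matrix_mulVec B)).add
      (memLp_of_hasLaw_gaussian (h.law_noise k))

/-- The state is a measurable function of the past initial state, noise and inputs. -/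
theorem exists_state_eq (h : IsBehaviorTrajectory P A B W x u w) (k j : ℕ) (hj : j ≤ k) :
    ∃ f : (Fin n → ℝ) × (Fin k → Fin n → ℝ) × (Fin (k + 1) → Fin m → ℝ) → Fin n → ℝ,
      Measurable f ∧ ∀ ω, x j ω = f (x 0 ω, (fun j : Fin k => w j ω),
        (fun j : Fin (k + 1) => u j ω)) := by
  -- The horizon `k` stays fixed while `j` grows, so the domain of `f` does not change.
  induction j with
  | zero => exact ⟨Prod.fst, measurable_fst, fun _ => rfl⟩
  | succ j ih =>
    obtain ⟨f, hf, hx⟩ := ih (by omega)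
    have hA : Measurable fun v : Fin n → ℝ => A *ᵥ v := by
      exact (by fun_prop : Continuous fun v : Fin n → ℝ => A *ᵥ v).measurable
    have hB : Measurable fun v : Fin m → ℝ => B *ᵥ v := by
      exact (by fun_prop : Continuous fun v : Fin m → ℝ => B *ᵥ v).measurable
    refine ⟨fun z => A *ᵥ f z + B *ᵥ z.2.2 ⟨j, by omega⟩ + z.2.1 ⟨j, by omega⟩, ?_, fun ω => ?_⟩
    · exact ((hA.comp hf).add (hB.comp (by fun_prop))).add (by fun_prop)
    · rw [h.dynamics, hx]

/-- The prediction is a function of the past data and of the current input, the last component of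
the input tuple. -/
theorem indepFun_noise (h : IsBehaviorTrajectory P A B W x u w) (k : ℕ) :
    IndepFun (w k) (fun ω => A *ᵥ x k ω + B *ᵥ u k ω) P := by
  obtain ⟨f, hf, hx⟩ := h.exists_state_eq k k le_rfl
  have hA : Measurable fun v : Fin n → ℝ => A *ᵥ v := by
    exact (by fun_prop : Continuous fun v : Fin n → ℝ => A *ᵥ v).measurable
  have hB : Measurable fun v : Fin m → ℝ => B *ᵥ v := by
    exact (by fun_prop : Continuous fun v : Fin m → ℝ => B *ᵥ v).measurable
  have := (h.indep_noise k).comp measurable_id (ψ := fun z => A *ᵥ f z + B *ᵥ z.2.2 (Fin.last k))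
    ((hA.comp hf).add (hB.comp (by fun_prop)))
  convert! this using 1
  funext ω
  simp [hx ω]

theorem memLp_prediction (h : IsBehaviorTrajectory P A B W x u w) (k : ℕ) :
    MemLp (fun ω => A *ᵥ x k ω + B *ᵥ u k ω) 2 P :=
  ((h.memLp_state k).matrix_mulVec A).add ((h.memLp_input k).matrix_mulVec B)

/-- The noise contributes `tr (X W)` to the expected quadratic form of the next state. -/
theorem integral_next_state [IsProbabilityMeasure P] (h : IsBehaviorTrajectory P A B W x u w)
    (hW : W.PosSemidef) (X : Matrix (Fin n) (Fin n) ℝ) (k : ℕ) :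
    ∫ ω, x (k + 1) ω ⬝ᵥ X *ᵥ x (k + 1) ω ∂P
      = ∫ ω, (A *ᵥ x k ω + B *ᵥ u k ω) ⬝ᵥ X *ᵥ (A *ᵥ x k ω + B *ᵥ u k ω) ∂P
        + (X * W).trace := by
  have hw := memLp_of_hasLaw_gaussian (h.law_noise k)
  have hz := h.memLp_prediction k
  have hind := h.indepFun_noise k
  have h0 : ∀ i j, ∫ ω, w k ω i * (A *ᵥ x k ω + B *ᵥ u k ω) j ∂P = 0 := fun i j => by
    have hij : IndepFun (fun ω => w k ω i) (fun ω => (A *ᵥ x k ω + B *ᵥ u k ω) j) P :=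
      hind.comp (measurable_pi_apply i) (measurable_pi_apply j)
    rw [hij.integral_fun_mul_eq_mul_integral ((memLp_pi_iff.1 hw) i).1 ((memLp_pi_iff.1 hz) j).1,
      integral_of_hasLaw_gaussian (h.law_noise k), zero_mul]
  have i1 := integrable_dotProduct_mulVec hz hz X
  have i2 := integrable_dotProduct_mulVec hz hw X
  have i3 := integrable_dotProduct_mulVec hw hz X
  have i4 := integrable_dotProduct_mulVec hw hw X
  have e2 := integral_dotProduct_mulVec hz hw X
  have e3 := integral_dotProduct_mulVec hw hz X
  have e4 := integral_dotProduct_mulVec hw hw X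
  simp only [h0, mul_zero, Finset.sum_const_zero] at e3
  simp only [mul_comm _ (w k _ _), h0, mul_zero, Finset.sum_const_zero] at e2
  simp only [integral_mul_of_hasLaw_gaussian hW (h.law_noise k)] at e4
  have ht : (X * W).trace = ∑ i, ∑ j, X i j * W i j := by
    simp only [trace, diag, Matrix.mul_apply]
    exact Finset.sum_congr rfl fun i _ => Finset.sum_congr rfl fun j _ => by
      rw [hW.isSymm.apply]
  -- The zero cross terms are reinserted as integrals, so that all four terms merge into one
  -- integrand.
  rw [ht, ← e4, ← add_zero (∫ ω, _ ∂P + _), ← e3, ← add_zero (∫ ω, _ ∂P + _ + _), ← e2,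
    ← integral_add' i1 i4, ← integral_add' (i1.add i4) i3, ← integral_add' ((i1.add i4).add i3) i2]
  refine integral_congr_ae (Eventually.of_forall fun ω => ?_)
  simp only [h.dynamics k, mulVec_add, dotProduct_add, add_dotProduct, Pi.add_apply]
  ring

end IsBehaviorTrajectory

/-! ### The off-policy residual -/

section Residual

variable {n m : ℕ} {Ω : Type*} [MeasurableSpace Ω] {P : Measure Ω}

/-- The residual of the off-policy Bellman equation for the gain `F`, for the mismatches `D`, `E₁`
and `E₂` in the policy evaluation equation and in the two auxiliary unknowns. -/
noncomputable def offPolicyResidual (P : Measure Ω) (γ : ℝ) (y : Ω → Fin n → ℝ)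
    (v : Ω → Fin m → ℝ) (F : Matrix (Fin m) (Fin n) ℝ) (D : Matrix (Fin n) (Fin n) ℝ)
    (E₁ : Matrix (Fin m) (Fin n) ℝ) (E₂ : Matrix (Fin m) (Fin m) ℝ) : ℝ :=
  ∫ ω, (y ω ⬝ᵥ D *ᵥ y ω + 2 * γ * ((v ω - F *ᵥ y ω) ⬝ᵥ E₁ *ᵥ y ω)
    + γ * ((v ω - F *ᵥ y ω) ⬝ᵥ E₂ *ᵥ (F *ᵥ y ω + v ω))) ∂P

/-- Changing the target gain amounts to changing the mismatch of the evaluation equation. -/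
theorem offPolicyResidual_change_gain (γ : ℝ) (y : Ω → Fin n → ℝ)
    (v : Ω → Fin m → ℝ) (F G : Matrix (Fin m) (Fin n) ℝ) (D : Matrix (Fin n) (Fin n) ℝ)
    (E₁ : Matrix (Fin m) (Fin n) ℝ) {E₂ : Matrix (Fin m) (Fin m) ℝ} (hE₂ : E₂.IsSymm) :
    offPolicyResidual P γ y v F D E₁ E₂ = offPolicyResidual P γ y v G
      (D + γ • ((G - F)ᵀ * E₁ + E₁ᵀ * (G - F) + (Gᵀ * E₂ * G - Fᵀ * E₂ * F))) E₁ E₂ := by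
  refine integral_congr_ae (Eventually.of_forall fun ω => ?_)
  simp only [Matrix.add_mulVec, Matrix.sub_mulVec, Matrix.smul_mulVec, dotProduct_add, dotProduct_sub, dotProduct_smul, ← Matrix.mulVec_mulVec,
    dotProduct_transpose_mulVec', sub_dotProduct, mulVec_add, mulVec_sub, smul_eq_mul]
  -- By symmetry `(v - Fy)'E₂(Fy + v) = v'E₂v - y'F'E₂Fy`, so the two gains differ by a quadratic
  -- form in `y` alone.
  rw [hE₂.dotProduct_mulVec_comm (v ω) (F *ᵥ y ω), hE₂.dotProduct_mulVec_comm (v ω) (G *ᵥ y ω),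
    dotProduct_comm (E₁ *ᵥ y ω) (G *ᵥ y ω), dotProduct_comm (E₁ *ᵥ y ω) (F *ᵥ y ω)]
  ring

end Residual

/-- With `e = u - Fx` and `z = Ax + Bu`, the difference of squares gives `z'Xz - x'(A+BF)'X(A+BF)x =
2e'B'XAx + e'B'XB(Fx + u)`. The trace terms cancel. -/
theorem IsBehaviorTrajectory.bellman_iff {n m : ℕ} {Ω : Type*} [MeasurableSpace Ω] {P : Measure Ω}
    {A : Matrix (Fin n) (Fin n) ℝ} {B : Matrix (Fin n) (Fin m) ℝ} {W : Matrix (Fin n) (Fin n) ℝ}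
    {x : ℕ → Ω → (Fin n → ℝ)} {u : ℕ → Ω → (Fin m → ℝ)} {w : ℕ → Ω → (Fin n → ℝ)}
    [IsProbabilityMeasure P] (h : IsBehaviorTrajectory P A B W x u w)
    (hW : W.PosSemidef) (Q : Matrix (Fin n) (Fin n) ℝ) (R : Matrix (Fin m) (Fin m) ℝ) (γ : ℝ)
    (F : Matrix (Fin m) (Fin n) ℝ) {X : Matrix (Fin n) (Fin n) ℝ} (hX : X.IsSymm)
    (X₁ : Matrix (Fin m) (Fin n) ℝ) (X₂ : Matrix (Fin m) (Fin m) ℝ) (k : ℕ) :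
    ((∫ ω, x k ω ⬝ᵥ X *ᵥ x k ω ∂P) - γ * (∫ ω, x (k + 1) ω ⬝ᵥ X *ᵥ x (k + 1) ω ∂P)
      = (∫ ω, x k ω ⬝ᵥ (Q + Fᵀ * R * F) *ᵥ x k ω ∂P)
        - 2 * γ * (∫ ω, (u k ω - F *ᵥ x k ω) ⬝ᵥ X₁ *ᵥ x k ω ∂P)
        - γ * (∫ ω, (u k ω - F *ᵥ x k ω) ⬝ᵥ X₂ *ᵥ (F *ᵥ x k ω + u k ω) ∂P)
        - γ * (X * W).trace) ↔
    offPolicyResidual P γ (x k) (u k) F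
      (X - (γ • ((A + B * F)ᵀ * X * (A + B * F)) + Fᵀ * R * F + Q))
      (X₁ - Bᵀ * X * A) (X₂ - Bᵀ * X * B) = 0 := by
  have hx := h.memLp_state k
  have hu := h.memLp_input k
  have hz := h.memLp_prediction k
  have hd : MemLp (fun ω => u k ω - F *ᵥ x k ω) 2 P := hu.sub (hx.matrix_mulVec F)
  have hs : MemLp (fun ω => F *ᵥ x k ω + u k ω) 2 P := (hx.matrix_mulVec F).add hu
  have i1 := integrable_dotProduct_mulVec hx hx X
  have i2 := (integrable_dotProduct_mulVec hz hz X).const_mul γ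
  have i3 := integrable_dotProduct_mulVec hx hx (Q + Fᵀ * R * F)
  have i4 := (integrable_dotProduct_mulVec hd hx X₁).const_mul (2 * γ)
  have i5 := (integrable_dotProduct_mulVec hd hs X₂).const_mul γ
  have key : offPolicyResidual P γ (x k) (u k) F
      (X - (γ • ((A + B * F)ᵀ * X * (A + B * F)) + Fᵀ * R * F + Q))
      (X₁ - Bᵀ * X * A) (X₂ - Bᵀ * X * B)
      = (∫ ω, x k ω ⬝ᵥ X *ᵥ x k ω ∂P)
        - γ * (∫ ω, (A *ᵥ x k ω + B *ᵥ u k ω) ⬝ᵥ X *ᵥ (A *ᵥ x k ω + B *ᵥ u k ω) ∂P)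
        - (∫ ω, x k ω ⬝ᵥ (Q + Fᵀ * R * F) *ᵥ x k ω ∂P)
        + 2 * γ * (∫ ω, (u k ω - F *ᵥ x k ω) ⬝ᵥ X₁ *ᵥ x k ω ∂P)
        + γ * (∫ ω, (u k ω - F *ᵥ x k ω) ⬝ᵥ X₂ *ᵥ (F *ᵥ x k ω + u k ω) ∂P) := by
    simp only [← integral_const_mul]
    rw [← integral_sub' i1 i2, ← integral_sub' (i1.sub i2) i3, ← integral_add' ((i1.sub i2).sub i3) i4,
      ← integral_add' (((i1.sub i2).sub i3).add i4) i5]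
    refine integral_congr_ae (Eventually.of_forall fun ω => ?_)
    simp only [Pi.sub_apply, Pi.add_apply, Matrix.add_mulVec, Matrix.sub_mulVec,
      Matrix.smul_mulVec, add_dotProduct, dotProduct_add, dotProduct_sub, dotProduct_smul, Matrix.mul_assoc, ← Matrix.mulVec_mulVec,
      dotProduct_transpose_mulVec', sub_dotProduct, mulVec_add, smul_eq_mul]
    rw [hX.dotProduct_mulVec_comm (A *ᵥ x k ω) (B *ᵥ u k ω),
      hX.dotProduct_mulVec_comm (A *ᵥ x k ω) (B *ᵥ F *ᵥ x k ω),
      hX.dotProduct_mulVec_comm (B *ᵥ u k ω) (B *ᵥ F *ᵥ x k ω)]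
    ring
  rw [key, h.integral_next_state hW]
  constructor <;> intro h' <;> linarith

/-! ### Transfer of excitation to all gains -/

section OffPolicy

variable {n m : ℕ} {Ω : Type*} [MeasurableSpace Ω] {P : Measure Ω}
  {A : Matrix (Fin n) (Fin n) ℝ} {B : Matrix (Fin n) (Fin m) ℝ} {W : Matrix (Fin n) (Fin n) ℝ}
  {x : ℕ → Ω → (Fin n → ℝ)} {u : ℕ → Ω → (Fin m → ℝ)} {w : ℕ → Ω → (Fin n → ℝ)}
  {Q : Matrix (Fin n) (Fin n) ℝ} {R : Matrix (Fin m) (Fin m) ℝ} {γ : ℝ} {T : Set ℕ}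

theorem IsBehaviorTrajectory.isOffPolicyEvaluation_iff [IsProbabilityMeasure P]
    (h : IsBehaviorTrajectory P A B W x u w) (hW : W.PosSemidef) {F : Matrix (Fin m) (Fin n) ℝ}
    {X : Matrix (Fin n) (Fin n) ℝ} {X₁ : Matrix (Fin m) (Fin n) ℝ} {X₂ : Matrix (Fin m) (Fin m) ℝ} :
    IsOffPolicyEvaluation P Q R W γ x u T F X X₁ X₂ ↔ X.IsSymm ∧ X₂.IsSymm ∧
      ∀ k ∈ T, offPolicyResidual P γ (x k) (u k) F
        (X - (γ • ((A + B * F)ᵀ * X * (A + B * F)) + Fᵀ * R * F + Q))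
        (X₁ - Bᵀ * X * A) (X₂ - Bᵀ * X * B) = 0 :=
  ⟨fun e => ⟨e.symm, e.symm₂, fun k hk => (h.bellman_iff hW Q R γ F e.symm X₁ X₂ k).1
      (e.bellman k hk)⟩,
    fun e => ⟨e.1, e.2.1, fun k hk => (h.bellman_iff hW Q R γ F e.1 X₁ X₂ k).2 (e.2.2 k hk)⟩⟩

theorem Matrix.IsSymm.transpose_mul_mul {X : Matrix (Fin n) (Fin n) ℝ} (hX : X.IsSymm)
    (N : Matrix (Fin n) (Fin m) ℝ) : (Nᵀ * X * N).IsSymm := by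
  simp [IsSymm, Matrix.mul_assoc, hX.eq]

/-- The value of a gain solves the off-policy evaluation equations. -/
theorem SolvesPolicyEvaluation.isOffPolicyEvaluation [IsProbabilityMeasure P]
    (h : IsBehaviorTrajectory P A B W x u w) (hW : W.PosSemidef) {F : Matrix (Fin m) (Fin n) ℝ}
    {X : Matrix (Fin n) (Fin n) ℝ} (hX : SolvesPolicyEvaluation A B Q R γ F X) (hs : X.IsSymm) :
    IsOffPolicyEvaluation P Q R W γ x u T F X (Bᵀ * X * A) (Bᵀ * X * B) := by
  refine (h.isOffPolicyEvaluation_iff hW).2 ⟨hs, hs.transpose_mul_mul B, fun k _ => ?_⟩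
  rw [sub_eq_zero.2 hX]
  simp [offPolicyResidual]

/-- Data that determine the evaluation of one stabilizing gain force every off-policy evaluation,
for any gain, to be a classical policy evaluation. -/
theorem IsOffPolicyEvaluation.classical [IsProbabilityMeasure P]
    (h : IsBehaviorTrajectory P A B W x u w) (hγ : 0 ≤ γ) (hQ : Q.PosSemidef) (hR : R.PosDef)
    (hW : W.PosSemidef)
    {F₀ : Matrix (Fin m) (Fin n) ℝ} (hF₀ : IsDiscountStabilizing A B γ F₀)
    (hrich : DataDetermineEvaluation P Q R W γ x u T F₀) {F : Matrix (Fin m) (Fin n) ℝ}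
    {X : Matrix (Fin n) (Fin n) ℝ} {X₁ : Matrix (Fin m) (Fin n) ℝ} {X₂ : Matrix (Fin m) (Fin m) ℝ}
    (e : IsOffPolicyEvaluation P Q R W γ x u T F X X₁ X₂) :
    SolvesPolicyEvaluation A B Q R γ F X ∧ X₁ = Bᵀ * X * A ∧ X₂ = Bᵀ * X * B := by
  obtain ⟨hX, hX₂, hr⟩ := (h.isOffPolicyEvaluation_iff hW).1 e
  have hD : (X - (γ • ((A + B * F)ᵀ * X * (A + B * F)) + Fᵀ * R * F + Q)).IsSymm :=
    hX.sub ((((hX.transpose_mul_mul _).smul γ).add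
      (hR.posSemidef.isSymm.transpose_mul_mul F)).add hQ.isSymm)
  have hE₂ : (X₂ - Bᵀ * X * B).IsSymm := hX₂.sub (hX.transpose_mul_mul B)
  suffices hz : X - (γ • ((A + B * F)ᵀ * X * (A + B * F)) + Fᵀ * R * F + Q) = 0 ∧
      X₁ - Bᵀ * X * A = 0 ∧ X₂ - Bᵀ * X * B = 0 from
    ⟨sub_eq_zero.1 hz.1, sub_eq_zero.1 hz.2.1, sub_eq_zero.1 hz.2.2⟩
  generalize X - (γ • ((A + B * F)ᵀ * X * (A + B * F)) + Fᵀ * R * F + Q) = D at *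
  generalize X₁ - Bᵀ * X * A = E₁ at *
  generalize X₂ - Bᵀ * X * B = E₂ at *
  obtain ⟨X0, hX0⟩ := hF₀.exists_value (Q := Q) (R := R) hγ
  have hs0 := (hX0.posSemidef hγ hQ hR hF₀).isSymm
  -- `V` is chosen so that `X0 + V` has, for `F₀`, exactly the mismatch obtained by moving the
  -- residual from `F` to `F₀`.
  obtain ⟨V, hV⟩ := hF₀.exists_lyapunov
    (D + γ • ((F₀ - F)ᵀ * E₁ + E₁ᵀ * (F₀ - F) + (F₀ᵀ * E₂ * F₀ - Fᵀ * E₂ * F)))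
  have hVs : V.IsSymm := by
    refine hF₀.lyapunov_isSymm ?_
    rw [hV]
    refine hD.add (IsSymm.smul (IsSymm.add ?_ ((hE₂.transpose_mul_mul F₀).sub
      (hE₂.transpose_mul_mul F))) γ)
    simp only [IsSymm, transpose_add, transpose_mul, transpose_transpose]
    exact add_comm _ _
  have hdiff : X0 + V - (γ • ((A + B * F₀)ᵀ * (X0 + V) * (A + B * F₀)) + F₀ᵀ * R * F₀ + Q)
      = D + γ • ((F₀ - F)ᵀ * E₁ + E₁ᵀ * (F₀ - F) + (F₀ᵀ * E₂ * F₀ - Fᵀ * E₂ * F)) := by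
    rw [← hV, ← smul_transpose_mul_mul_eq hγ, Matrix.mul_add _ X0 V, Matrix.add_mul, smul_add]
    nth_rw 1 [hX0]
    abel
  obtain ⟨h1, h2, h3⟩ := hrich (X0 + V) (Bᵀ * (X0 + V) * A + E₁) (Bᵀ * (X0 + V) * B + E₂) _ _ _
    ((h.isOffPolicyEvaluation_iff hW).2 ⟨hs0.add hVs,
      ((hs0.add hVs).transpose_mul_mul B).add hE₂, fun k hk => by
        rw [hdiff, add_sub_cancel_left, add_sub_cancel_left,
          ← offPolicyResidual_change_gain γ _ _ F F₀ D E₁ hE₂]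
        exact hr k hk⟩)
    (hX0.isOffPolicyEvaluation h hW hs0)
  rw [h1, add_eq_left] at h2 h3
  rw [add_eq_left] at h1
  refine ⟨?_, h2, h3⟩
  -- With `V`, `E₁` and `E₂` zero, `hV` reduces to `D = 0`.
  rw [h1, h2, h3] at hV
  simpa using hV.symm

theorem IsDiscountStabilizing.dataDetermineEvaluation [IsProbabilityMeasure P]
    (h : IsBehaviorTrajectory P A B W x u w) (hγ : 0 ≤ γ) (hQ : Q.PosSemidef) (hR : R.PosDef)
    (hW : W.PosSemidef)
    {F₀ : Matrix (Fin m) (Fin n) ℝ} (hF₀ : IsDiscountStabilizing A B γ F₀)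
    (hrich : DataDetermineEvaluation P Q R W γ x u T F₀) {F : Matrix (Fin m) (Fin n) ℝ}
    (hF : IsDiscountStabilizing A B γ F) : DataDetermineEvaluation P Q R W γ x u T F := by
  intro X X₁ X₂ Y Y₁ Y₂ hX hY
  obtain ⟨a, b, c⟩ := hX.classical h hγ hQ hR hW hF₀ hrich
  obtain ⟨a', b', c'⟩ := hY.classical h hγ hQ hR hW hF₀ hrich
  obtain rfl := a.unique hγ a' hF
  exact ⟨rfl, b.trans b'.symm, c.trans c'.symm⟩

/-- The evaluation equations are classical before stability is known, so the induction carries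
stability alone. -/
theorem IsOffPolicyIteration.classical {p : ℕ} {C : Matrix (Fin n) (Fin p) ℝ}
    [IsProbabilityMeasure P]
    (h : IsBehaviorTrajectory P A B W x u w) (hγ₀ : 0 < γ) (hγ₁ : γ < 1) (hQ : Q.PosSemidef)
    (hR : R.PosDef) (hW : W.PosSemidef) (hC : C * Cᵀ = Q) (hdet : IsDetectable A Cᵀ)
    {F₀ : Matrix (Fin m) (Fin n) ℝ} (hF₀ : IsDiscountStabilizing A B γ F₀)
    (hrich : DataDetermineEvaluation P Q R W γ x u T F₀) {F : ℕ → Matrix (Fin m) (Fin n) ℝ}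
    {X : ℕ → Matrix (Fin n) (Fin n) ℝ} {X₁ : ℕ → Matrix (Fin m) (Fin n) ℝ}
    {X₂ : ℕ → Matrix (Fin m) (Fin m) ℝ}
    (hI : IsOffPolicyIteration P Q R W γ x u T F₀ F X X₁ X₂) (s : ℕ) :
    IsDiscountStabilizing A B γ (F s) ∧ SolvesPolicyEvaluation A B Q R γ (F s) (X s) ∧
      X₁ s = Bᵀ * X s * A ∧ X₂ s = Bᵀ * X s * B ∧ F (s + 1) = gainOf A B R γ (X s) := by
  have hc := fun s => (hI.evaluation s).classical h hγ₀.le hQ hR hW hF₀ hrich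
  have hstep : ∀ s, F (s + 1) = gainOf A B R γ (X s) := fun s => by
    rw [hI.improvement s, (hc s).2.1, (hc s).2.2, gainOf]
  refine ⟨?_, (hc s).1, (hc s).2.1, (hc s).2.2, hstep s⟩
  induction s with
  | zero => rw [hI.init]; exact hF₀
  | succ s ih =>
    rw [hstep s]
    exact (hc s).1.improved_stabilizing hγ₀ hγ₁ hR hC hdet ((hc s).1.posSemidef hγ₀.le hQ hR ih)

/-- Classical policy iteration maps the discount stabilizing gains to themselves, and its values
solve the off-policy equations. -/
theorem exists_isOffPolicyIteration {p : ℕ} {C : Matrix (Fin n) (Fin p) ℝ}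
    [IsProbabilityMeasure P]
    (h : IsBehaviorTrajectory P A B W x u w) (hγ₀ : 0 < γ) (hγ₁ : γ < 1) (hQ : Q.PosSemidef)
    (hR : R.PosDef) (hW : W.PosSemidef) (hC : C * Cᵀ = Q) (hdet : IsDetectable A Cᵀ)
    {F₀ : Matrix (Fin m) (Fin n) ℝ} (hF₀ : IsDiscountStabilizing A B γ F₀) :
    ∃ F X X₁ X₂, IsOffPolicyIteration P Q R W γ x u T F₀ F X X₁ X₂ := by
  have hval : ∀ F : {F : Matrix (Fin m) (Fin n) ℝ // IsDiscountStabilizing A B γ F},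
      ∃ X, SolvesPolicyEvaluation A B Q R γ F X := fun F => F.2.exists_value hγ₀.le
  choose V hV using hval
  have hpsd := fun F => (hV F).posSemidef hγ₀.le hQ hR F.2
  let next : {F : Matrix (Fin m) (Fin n) ℝ // IsDiscountStabilizing A B γ F} →
      {F : Matrix (Fin m) (Fin n) ℝ // IsDiscountStabilizing A B γ F} := fun F =>
    ⟨gainOf A B R γ (V F), (hV F).improved_stabilizing hγ₀ hγ₁ hR hC hdet (hpsd F)⟩
  let G : ℕ → {F : Matrix (Fin m) (Fin n) ℝ // IsDiscountStabilizing A B γ F} :=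
    fun s => next^[s] ⟨F₀, hF₀⟩
  exact ⟨fun s => (G s).1, fun s => V (G s), fun s => Bᵀ * V (G s) * A, fun s => Bᵀ * V (G s) * B,
    rfl, fun s => (hV (G s)).isOffPolicyEvaluation h hW (hpsd (G s)).isSymm, fun s => by
      simp only [G, Function.iterate_succ_apply']
      rfl⟩

end OffPolicy

/-! ### The main theorem -/

theorem theorem1 {n m p : ℕ}
    (A : Matrix (Fin n) (Fin n) ℝ) (B : Matrix (Fin n) (Fin m) ℝ)
    (Q : Matrix (Fin n) (Fin n) ℝ) (R : Matrix (Fin m) (Fin m) ℝ)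
    (C : Matrix (Fin n) (Fin p) ℝ) (W : Matrix (Fin n) (Fin n) ℝ)
    (γ : ℝ) (hγ₀ : 0 < γ) (hγ₁ : γ < 1)
    (hQ : Q.PosSemidef) (hR : R.PosDef) (hW : W.PosSemidef)
    (hC : C * Cᵀ = Q) (hdet : IsDetectable A Cᵀ)
    {Ω : Type*} [MeasurableSpace Ω] (P : Measure Ω) [IsProbabilityMeasure P]
    (x : ℕ → Ω → (Fin n → ℝ)) (u : ℕ → Ω → (Fin m → ℝ)) (w : ℕ → Ω → (Fin n → ℝ))
    (hdata : IsBehaviorTrajectory P A B W x u w) (T : Set ℕ)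
    (F₀ : Matrix (Fin m) (Fin n) ℝ) (hF₀ : F₀ ∈ stabilizingGains A B)
    (hrich : DataDetermineEvaluation P Q R W γ x u T F₀) :
    -- the algorithm can be run
    (∃ F X X₁ X₂, IsOffPolicyIteration P Q R W γ x u T F₀ F X X₁ X₂) ∧
    -- the Riccati equation has a unique positive semidefinite solution, and every run converges
    ∃ Xstar : Matrix (Fin n) (Fin n) ℝ,
      (Xstar.PosSemidef ∧ SolvesARE A B Q R γ Xstar) ∧
      (∀ Y : Matrix (Fin n) (Fin n) ℝ, Y.PosSemidef → SolvesARE A B Q R γ Y → Y = Xstar) ∧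
      ∀ F X X₁ X₂, IsOffPolicyIteration P Q R W γ x u T F₀ F X X₁ X₂ →
        -- each evaluation step has no other solution and agrees with classical policy iteration
        (∀ s, DataDetermineEvaluation P Q R W γ x u T (F s) ∧
          X s = γ • ((A + B * F s)ᵀ * X s * (A + B * F s)) + (F s)ᵀ * R * F s + Q ∧
          X₁ s = Bᵀ * X s * A ∧ X₂ s = Bᵀ * X s * B ∧
          F (s + 1) = gainOf A B R γ (X s)) ∧
        Tendsto X atTop (𝓝 Xstar) ∧
        Tendsto F atTop (𝓝 (gainOf A B R γ Xstar)) := by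
  have hst : IsDiscountStabilizing A B γ F₀ :=
    isPowerStable_smul (Real.sqrt_pos.2 hγ₀) ((Real.sqrt_lt' one_pos).2 (by simpa)) hF₀
  have hcl : ∀ F X X₁ X₂, IsOffPolicyIteration P Q R W γ x u T F₀ F X X₁ X₂ → ∀ s, _ :=
    fun _ _ _ _ hI => hI.classical hdata hγ₀ hγ₁ hQ hR hW hC hdet hst hrich
  have hconv : ∀ F X X₁ X₂, IsOffPolicyIteration P Q R W γ x u T F₀ F X X₁ X₂ → _ :=
    fun F X X₁ X₂ hI => policyIteration_converges hγ₀.le hQ hR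
      (fun s => (hcl F X X₁ X₂ hI s).1) (fun s => (hcl F X X₁ X₂ hI s).2.1)
      fun s => (hcl F X X₁ X₂ hI s).2.2.2.2
  obtain ⟨F, X, X₁, X₂, hI⟩ :=
    exists_isOffPolicyIteration (T := T) hdata hγ₀ hγ₁ hQ hR hW hC hdet hst
  -- One run supplies the Riccati solution; uniqueness identifies the limit of every other run with
  -- it.
  obtain ⟨Xstar, hpsd, hare, -, -⟩ := hconv F X X₁ X₂ hI
  have huniq : ∀ Y : Matrix (Fin n) (Fin n) ℝ, Y.PosSemidef → SolvesARE A B Q R γ Y → Y = Xstar :=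
    fun Y hY hY' => hY'.unique hγ₀ hγ₁ hR hC hdet hY hpsd hare
  refine ⟨⟨F, X, X₁, X₂, hI⟩, Xstar, ⟨hpsd, hare⟩, huniq, fun F X X₁ X₂ hI => ⟨fun s => ?_, ?_⟩⟩
  · obtain ⟨h1, h2⟩ := hcl F X X₁ X₂ hI s
    exact ⟨hst.dataDetermineEvaluation hdata hγ₀.le hQ hR hW hrich h1, h2⟩
  · obtain ⟨Y, hY, hY', hlim⟩ := hconv F X X₁ X₂ hI
    obtain rfl := huniq Y hY hY'
    exact hlim
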